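/- **Setting.** Let $X,Z$ be the single-qubit Pauli matrices. For $a\in\mathbb Z_2^{2n}$ let $P_a=\bigotimes_{k=1}^n i^{a_{x,k}a_{z,k}}X^{a_{x,k}}Z^{a_{z,k}}$ be the corresponding $n$-qubit Pauli operator. An $n$-qubit Pauli channel is a map $\Lambda(\rho)=\sum_a p_aP_a\rho P_a$ with $p_a\ge 0$ and $\sum_a p_a=1$; its Pauli eigenvalues are $\lambda_a=2^{-n}\operatorname{Tr}[P_a\Lambda(P_a)]$. A *classical-memory-assisted (entanglement-free) scheme* using $N\ge1$ copies of $\Lambda$ consists of: - classical registers with finite, arbitrarily large alphabets, with contents $o_0,\dots,o_N$; - an ensemble of positive semidefinite operators $\rho_{o_0}$ on the $n$-qubit space with $\sum_{o_0}\operatorname{Tr}\rho_{o_0}=1$; - for $1\le t\le N-1$ and every history $o_{<t}=(o_0,\dots,o_{t-1})$, a quantum instrument $\{\mathcal C^{o_{<t}}_{o_t}\}_{o_t}$ on the $n$-qubit system, i.e. completely positive maps whose sum over $o_t$ is trace preserving; - for every history $o_{<N}$, a final POVM $\{E^{o_{<N}}_{o_N}\}_{o_N}$. When the unknown channel is $\Lambda$,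 the outcome sequence $o=(o_0,\dots,o_N)$ has probability $$\Pr[o\mid\Lambda]=\operatorname{Tr}\Bigl[E^{o_{<N}}_{o_N}\bigl(\Lambda\circ\mathcal C^{o_{<N-1}}_{o_{N-1}}\circ\cdots\circ\Lambda\circ\mathcal C^{o_{<1}}_{o_1}\circ\Lambda\bigr)(\rho_{o_0})\Bigr].$$ An instrument is *trivial* if each of its maps is proportional to a completely positive trace-preserving map; a POVM is trivial if each of its elements is proportional to the identity. The *number of measurements* $N_{\mathrm{meas}}$ of the scheme is the maximum, over all outcome sequences $o$ that have positive probability for some Pauli channel, of the number of non-trivial measurements among the $N-1$ instruments and the final POVM used along $o$. In particular $N_{\mathrm{meas}}\le N$. **Theorem.** Let $n\ge 0$ and $0<\varepsilon\le 1/6$. Suppose that there are a classical-memory-assisted scheme using $N$ copies and estimators $\widehat\lambda_a$ ($a\in\mathbb Z_2^{2n}$), real functions of the outcome sequence $o$, such that for every $n$-qubit Pauli channel $\Lambda$ and every $a$, $$\Pr\bigl[\,|\widehat\lambda_a-\lambda_a|\le\varepsilon\,\big|\,\Lambda\bigr]\ge\tfrac23 .$$ Then $$N\ \ge\ N_{\mathrm{meas}}\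 \ge\ 0.005\cdot\frac{4^n-1}{2^n\varepsilon^2}.$$ Consequently there is a universal constant $c>0$ such that, for all $n\ge1$, every such scheme satisfies $N\ge N_{\mathrm{meas}}\ge c\,2^n/\varepsilon^2$; that is, both are $\Omega(2^n/\varepsilon^2)$. -/

import Mathlib

noncomputable section

namespace PauliLearning

open scoped ComplexOrder MatrixOrder Matrix.Norms.L2Operator CStarAlgebra

/-- Operators on the `n`-qubit Hilbert space `(ℂ²)^{⊗ n}`, as matrices in the computational basis
of bit strings `Fin n → Fin 2`. With the scoped instances opened above, this type carries the
L2-operator norm, the C⋆-algebra structure and the Loewner order (`0 ≤ A` iff `A.PosSemidef`). -/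
abbrev Op (n : ℕ) : Type := Matrix (Fin n → Fin 2) (Fin n → Fin 2) ℂ

/-! ### Pauli operators and Pauli channels -/

/-- Labels of `n`-qubit Pauli operators: `a k = (a_{x,k}, a_{z,k})`, i.e. elements of `ℤ₂^{2n}`. -/
abbrev PauliIdx (n : ℕ) : Type := Fin n → ZMod 2 × ZMod 2

/-- The single-qubit operator `i^{xz} X^x Z^z`. -/
def pauli₁ (b : ZMod 2 × ZMod 2) : Matrix (Fin 2) (Fin 2) ℂ :=
  Complex.I ^ (b.1.val * b.2.val) • (!![0, 1; 1, 0] ^ b.1.val * !![1, 0; 0, -1] ^ b.2.val)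

/-- The `n`-qubit Pauli operator `P_a = ⨂ₖ i^{a_{x,k} a_{z,k}} X^{a_{x,k}} Z^{a_{z,k}}`. -/
def pauli {n : ℕ} (a : PauliIdx n) : Op n :=
  Matrix.of fun x y => ∏ k, pauli₁ (a k) (x k) (y k)

/-- The map `ρ ↦ ∑ₐ pₐ Pₐ ρ Pₐ`; a Pauli channel when the error rates `p` form a probability
vector. -/
def pauliMap {n : ℕ} (p : PauliIdx n → ℝ) (ρ : Op n) : Op n :=
  ∑ a, (p a : ℂ) • (pauli a * ρ * pauli a)

/-- `Λ` is an `n`-qubit Pauli channel. -/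
def IsPauliChannel {n : ℕ} (Λ : Op n → Op n) : Prop :=
  ∃ p ∈ stdSimplex ℝ (PauliIdx n), Λ = pauliMap p

/-- The Pauli eigenvalue (Pauli fidelity) `λ_a = Tr[P_a Λ(P_a)] / 2^n`; it is a real number for
every Pauli channel. -/
def pauliEigenvalue {n : ℕ} (Λ : Op n → Op n) (a : PauliIdx n) : ℝ :=
  ((pauli a * Λ (pauli a)).trace / 2 ^ n).re

/-! ### Instruments and POVMs with finitely many outcomes -/

/-- The completely positive maps `C o` form a quantum instrument: `ρ ↦ ∑ₒ |o⟩⟨o| ⊗ C o ρ` is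
trace preserving. (Each `C o` is then automatically trace non-increasing.) -/
def IsInstrument {n : ℕ} {A : Type} [Fintype A] (C : A → (Op n →CP Op n)) : Prop :=
  ∀ ρ : Op n, ∑ o, (C o ρ).trace = ρ.trace

/-- An instrument is trivial if each of its maps is proportional to a quantum channel (a completely
positive trace-preserving map). -/
def IsTrivialInstrument {n : ℕ} {A : Type} (C : A → (Op n →CP Op n)) : Prop :=
  ∀ o, ∃ (c : ℝ) (Φ : Op n →CP Op n),
    (∀ ρ, (Φ ρ).trace = ρ.trace) ∧ ∀ ρ, C o ρ = (c : ℂ) • Φ ρ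

/-- `E` is a positive-operator-valued measure. -/
def IsPOVM {n : ℕ} {A : Type} [Fintype A] (E : A → Op n) : Prop :=
  (∀ o, (E o).PosSemidef) ∧ ∑ o, E o = 1

/-- A POVM is trivial if each of its elements is proportional to the identity, i.e. each
`ρ ↦ Tr[E o ρ]` is proportional to the trace. -/
def IsTrivialPOVM {n : ℕ} {A : Type} (E : A → Op n) : Prop :=
  ∀ o, ∃ c : ℝ, E o = (c : ℂ) • (1 : Op n)

/-! ### Classical-memory-assisted schemes -/

/-- Contents `(o_0, …, o_{t-1})` of the first `t` classical registers. -/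
abbrev Hist (A : ℕ → Type) (t : ℕ) : Type := (k : Fin t) → A k

/-- A classical-memory-assisted scheme on `n` qubits with `m` intermediate instruments; it uses
`m + 1` copies of the unknown channel.

Register `0` records the label of the initial state, register `t + 1` (`t < m`) records the outcome
of the `(t + 1)`-st instrument, and register `m + 1` records the outcome of the final POVM.
Each instrument and the POVM may depend on the contents of all earlier registers. Only the registers
with index at most `m + 1` and the instruments `instr t` with `t < m` are ever used. -/
structure Scheme (n m : ℕ) where
  /-- the alphabets of the classical registers, finite but arbitrarily large -/
  A : ℕ → Type
  [fin : ∀ t, Fintype (A t)]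
  /-- the ensemble of sub-normalized initial states -/
  init : A 0 → Op n
  init_posSemidef : ∀ o, (init o).PosSemidef
  init_trace : ∑ o, (init o).trace = 1
  /-- the adaptively chosen instruments between consecutive copies of the channel -/
  instr : (t : ℕ) → Hist A (t + 1) → A (t + 1) → (Op n →CP Op n)
  instr_isInstrument : ∀ t < m, ∀ h, IsInstrument (instr t h)
  /-- the adaptively chosen final measurement -/
  povm : Hist A (m + 1) → A (m + 1) → Op n
  povm_isPOVM : ∀ h, IsPOVM (povm h)

attribute [instance] Scheme.fin

namespace Scheme

variable {n m : ℕ} (S : Scheme n m)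

/-- Complete outcome sequences `(o_0, …, o_{m+1})`. -/
abbrev Outcome : Type := Hist S.A (m + 2)

/-- The number of copies of the unknown channel used by the scheme. -/
def numCopies (_S : Scheme n m) : ℕ := m + 1

/-- The unnormalized state fed into the `(t + 1)`-st copy of `Λ` after `(o_0, …, o_t)` has been
recorded: `(C_{o_t} ∘ Λ ∘ ⋯ ∘ C_{o_1} ∘ Λ)(ρ_{o_0})`. -/
def state (Λ : Op n → Op n) : (t : ℕ) → Hist S.A (t + 1) → Op n
  | 0, h => S.init (h 0)
  | t + 1, h =>
      S.instr t (fun k => h k.castSucc) (h (Fin.last (t + 1)))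
        (Λ (state Λ t fun k => h k.castSucc))

/-- The probability `Pr[o | Λ]` of the outcome sequence `o` when the unknown channel is `Λ`. -/
def prob (Λ : Op n → Op n) (o : S.Outcome) : ℝ :=
  (S.povm (fun k => o k.castSucc) (o (Fin.last (m + 1))) *
    Λ (S.state Λ m fun k => o k.castSucc)).trace.re

open Classical in
/-- The number of non-trivial measurements made along the outcome sequence `o`, where the final
POVM counts if it is non-trivial. -/
def measCount (o : S.Outcome) : ℕ :=
  (Finset.univ.filter fun t : Fin m =>
      ¬ IsTrivialInstrument
        (S.instr t fun k => o (k.castLE (Nat.succ_le_succ (t.isLt.le.trans (Nat.le_succ m)))))).card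
    + if IsTrivialPOVM (S.povm fun k => o k.castSucc) then 0 else 1

open Classical in
/-- The number of measurements `N_meas` of the scheme: the largest number of non-trivial
measurements made along an outcome sequence that can occur, i.e. that has positive probability for
some Pauli channel. -/
def numMeas : ℕ :=
  (Finset.univ.filter fun o : S.Outcome => ∃ Λ, IsPauliChannel Λ ∧ 0 < S.prob Λ o).sup S.measCount

open Classical in
/-- The scheme together with the classical post-processing `est` estimates every single Pauli
eigenvalue of every Pauli channel to within `ε` with probability at least `2/3`. -/
def Learns (est : S.Outcome → PauliIdx n → ℝ) (ε : ℝ) : Prop :=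
  ∀ Λ : Op n → Op n, IsPauliChannel Λ → ∀ a : PauliIdx n,
    2 / 3 ≤ ∑ o ∈ Finset.univ.filter fun o : S.Outcome =>
      |est o a - pauliEigenvalue Λ a| ≤ ε, S.prob Λ o

end Scheme

end PauliLearning

end

/-! Every scheme is tested on the completely depolarizing channel `depol` and the channels
`spikeChannel a (±2ε)`, `a ≠ 0`, whose only nonzero eigenvalues are `λ_0 = 1` and `λ_a = ±2ε`.

Lower bound: the sign of the estimate of `λ_a` separates `2ε` from `-2ε`, so the outcome law under
`depol` is far from at least one of the two. With relative entropy dominating squared total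
variation (`sq_sub_le_relEntropy`), the two relative entropies add up to at least `1/18` for each of
the `4^n - 1` labels (`Learns.relEntropy_ge`).

Upper bound: by the chain rule the relative entropy of the classical record accumulates round by
round. Without quantum memory, the current state enters the outcome law only through a scalar `Tr[σ
P_a] / Tr σ` in `[-1, 1]`, so a round with effects `E` costs at most `θ² · povmInfo E a` on average
(`relEntropy_step`). For a fixed history, Parseval and `Tr E² ≤ (Tr E)²` bound the sum of `povmInfo
E a` over `a` by `2^n`, and it is zero when `E` is trivial (`IsPOVM.sum_povmInfo_le`,
`IsTrivialPOVM.povmInfo_eq_zero`). The law of histories under `depol` does not depend on `a`, so the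
sum over `a` of the relative entropies is at most `θ² 2^n` times the mean number of non-trivial
measurements (`sum_relEntropy_prob_le`), which is at most `numMeas`.

Together, `(4^n - 1) / 18 ≤ 2 · (2ε)² · 2^n · numMeas`. -/

noncomputable section

namespace PauliLearning

open scoped ComplexOrder MatrixOrder Matrix.Norms.L2Operator CStarAlgebra

/-! ### Algebra of Pauli operators -/

/-- The tensor product `⨂ₖ M k` of single-qubit operators. -/
def tensor {n : ℕ} (M : Fin n → Matrix (Fin 2) (Fin 2) ℂ) : Op n :=
  Matrix.of fun x y => ∏ k, M k (x k) (y k)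

theorem pauli_eq_tensor {n : ℕ} (a : PauliIdx n) : pauli a = tensor fun k => pauli₁ (a k) := rfl

theorem tensor_mul {n : ℕ} (M M' : Fin n → Matrix (Fin 2) (Fin 2) ℂ) :
    tensor M * tensor M' = tensor fun k => M k * M' k := by
  ext x y
  simp only [tensor, Matrix.mul_apply, Matrix.of_apply, ← Finset.prod_mul_distrib]
  exact (Fintype.prod_sum fun k j => M k (x k) j * M' k j (y k)).symm

theorem tensor_smul {n : ℕ} (c : Fin n → ℂ) (M : Fin n → Matrix (Fin 2) (Fin 2) ℂ) :
    (tensor fun k => c k • M k) = (∏ k, c k) • tensor M := by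
  ext x y
  simp [tensor, Finset.prod_mul_distrib]

theorem tensor_one {n : ℕ} : tensor (fun _ : Fin n => 1) = 1 := by
  ext x y
  simp only [tensor, Matrix.of_apply, Matrix.one_apply]
  rw [Fintype.prod_ite_zero]
  simp [funext_iff]

theorem trace_tensor {n : ℕ} (M : Fin n → Matrix (Fin 2) (Fin 2) ℂ) :
    (tensor M).trace = ∏ k, (M k).trace := by
  simp only [tensor, Matrix.trace, Matrix.diag, Matrix.of_apply]
  exact (Fintype.prod_sum fun k j => M k j j).symm

theorem pauli₁_cases {p : ZMod 2 × ZMod 2 → Prop} (h00 : p (0, 0)) (h01 : p (0, 1))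
    (h10 : p (1, 0)) (h11 : p (1, 1)) (b : ZMod 2 × ZMod 2) : p b := by
  obtain ⟨x, z⟩ := b
  fin_cases x <;> fin_cases z <;> assumption

theorem pauli₁_zero_zero : pauli₁ (0, 0) = 1 := by simp [pauli₁]

theorem pauli₁_zero_one : pauli₁ (0, 1) = !![1, 0; 0, -1] := by
  simp [pauli₁, ZMod.val_one]

theorem pauli₁_one_zero : pauli₁ (1, 0) = !![0, 1; 1, 0] := by
  simp [pauli₁, ZMod.val_one]

theorem pauli₁_one_one : pauli₁ (1, 1) = !![0, -Complex.I; Complex.I, 0] := by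
  simp [pauli₁, ZMod.val_one]

theorem pauli₁_mul_self (b : ZMod 2 × ZMod 2) : pauli₁ b * pauli₁ b = 1 := by
  induction b using pauli₁_cases <;>
    simp [pauli₁_zero_zero, pauli₁_zero_one, pauli₁_one_zero, pauli₁_one_one, Matrix.one_fin_two]

theorem pauli₁_conjTranspose (b : ZMod 2 × ZMod 2) : (pauli₁ b).conjTranspose = pauli₁ b := by
  induction b using pauli₁_cases <;> ext i j <;> fin_cases i <;> fin_cases j <;>
    simp [pauli₁_zero_zero, pauli₁_zero_one, pauli₁_one_zero, pauli₁_one_one]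

theorem trace_pauli₁ {b : ZMod 2 × ZMod 2} (hb : b ≠ 0) : (pauli₁ b).trace = 0 := by
  revert hb
  induction b using pauli₁_cases <;>
    simp [pauli₁_zero_one, pauli₁_one_zero, pauli₁_one_one, Matrix.trace]

theorem pauli₁_conj (b c : ZMod 2 × ZMod 2) :
    ∃ s : ℝ, (s = 1 ∨ s = -1) ∧ pauli₁ b * pauli₁ c * pauli₁ b = (s : ℂ) • pauli₁ c := by
  have key : pauli₁ b * pauli₁ c * pauli₁ b = (1 : ℂ) • pauli₁ c ∨
      pauli₁ b * pauli₁ c * pauli₁ b = (-1 : ℂ) • pauli₁ c := by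
    induction b using pauli₁_cases <;> induction c using pauli₁_cases <;>
      simp [pauli₁_zero_zero, pauli₁_zero_one, pauli₁_one_zero, pauli₁_one_one,
        Matrix.one_fin_two]
  rcases key with h | h
  · exact ⟨1, Or.inl rfl, by simpa using h⟩
  · exact ⟨-1, Or.inr rfl, by simpa using h⟩

/-- `∑_b P_b ⊗ P_b` is twice the swap operator. -/
theorem sum_pauli₁_apply_mul_apply (x y z w : Fin 2) :
    ∑ b, pauli₁ b x y * pauli₁ b z w = if x = w ∧ y = z then 2 else 0 := by
  have h (f : ZMod 2 × ZMod 2 → ℂ) : ∑ b, f b = f (0, 0) + f (0, 1) + (f (1, 0) + f (1, 1)) := by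
    rw [Fintype.sum_prod_type]
    simp only [show (Finset.univ : Finset (ZMod 2)) = {0, 1} from rfl]
    simp
  rw [h, pauli₁_zero_zero, pauli₁_zero_one, pauli₁_one_zero, pauli₁_one_one]
  fin_cases x <;> fin_cases y <;> fin_cases z <;> fin_cases w <;> simp <;> norm_num

variable {n : ℕ}

theorem pauli_mul_self (a : PauliIdx n) : pauli a * pauli a = 1 := by
  simp [pauli_eq_tensor, tensor_mul, pauli₁_mul_self, tensor_one]

theorem pauli_conjTranspose (a : PauliIdx n) : (pauli a).conjTranspose = pauli a := by
  ext x y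
  simp only [pauli, Matrix.conjTranspose_apply, Matrix.of_apply, star_prod]
  refine Finset.prod_congr rfl fun k _ => ?_
  rw [← Matrix.conjTranspose_apply, pauli₁_conjTranspose]

theorem trace_pauli {a : PauliIdx n} (ha : a ≠ 0) : (pauli a).trace = 0 := by
  obtain ⟨k, hk⟩ := Function.ne_iff.mp ha
  rw [pauli_eq_tensor, trace_tensor]
  exact Finset.prod_eq_zero (Finset.mem_univ k) (trace_pauli₁ hk)

theorem trace_one_op : (1 : Op n).trace = 2 ^ n := by simp

theorem pauli_conj (a b : PauliIdx n) :
    ∃ s : ℝ, (s = 1 ∨ s = -1) ∧ pauli a * pauli b * pauli a = (s : ℂ) • pauli b := by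
  choose s hs h using fun k => pauli₁_conj (a k) (b k)
  refine ⟨∏ k, s k, ?_, ?_⟩
  · refine Finset.prod_induction s (fun r => r = 1 ∨ r = -1) ?_ (Or.inl rfl) fun k _ => hs k
    rintro _ _ (rfl | rfl) (rfl | rfl) <;> simp
  · simp only [pauli_eq_tensor, tensor_mul, h, tensor_smul, Complex.ofReal_prod]

/-- The sign `±1` by which `P_a` and `P_b` commute. -/
def commSign (a b : PauliIdx n) : ℝ := (pauli_conj a b).choose

theorem commSign_eq (a b : PauliIdx n) : commSign a b = 1 ∨ commSign a b = -1 :=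
  (pauli_conj a b).choose_spec.1

theorem pauli_mul_pauli_mul_pauli (a b : PauliIdx n) :
    pauli a * pauli b * pauli a = (commSign a b : ℂ) • pauli b :=
  (pauli_conj a b).choose_spec.2

/-- `∑_b P_b ⊗ P_b` is `2^n` times the swap operator. -/
theorem sum_pauli_apply_mul_apply (x y z w : Fin n → Fin 2) :
    ∑ b : PauliIdx n, pauli b x y * pauli b z w = if x = w ∧ y = z then 2 ^ n else 0 := by
  simp only [pauli, Matrix.of_apply, ← Finset.prod_mul_distrib]
  rw [← Fintype.prod_sum fun k b => pauli₁ b (x k) (y k) * pauli₁ b (z k) (w k)]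
  simp only [sum_pauli₁_apply_mul_apply]
  rw [Fintype.prod_ite_zero]
  simp [funext_iff, forall_and]

/-- The Pauli twirl: contracting the swap identity with `ρ` leaves only its trace. -/
theorem sum_pauli_mul_mul_pauli (ρ : Op n) :
    ∑ b, pauli b * ρ * pauli b = (2 ^ n * ρ.trace) • (1 : Op n) := by
  ext x w
  simp only [Matrix.sum_apply, Matrix.mul_apply, Finset.sum_mul, Matrix.smul_apply, smul_eq_mul]
  rw [Finset.sum_comm]
  calc ∑ z, ∑ b : PauliIdx n, ∑ y, pauli b x y * ρ y z * pauli b z w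
      = ∑ z, ∑ y, ρ y z * ∑ b : PauliIdx n, pauli b x y * pauli b z w := by
        refine Finset.sum_congr rfl fun z _ => ?_
        rw [Finset.sum_comm]
        refine Finset.sum_congr rfl fun y _ => ?_
        rw [Finset.mul_sum]
        exact Finset.sum_congr rfl fun b _ => by ring
    _ = _ := by
        simp only [sum_pauli_apply_mul_apply, Matrix.trace, Matrix.diag, Matrix.one_apply]
        by_cases h : x = w
        · simp [h, ← Finset.sum_mul, mul_comm]
        · simp [h]

/-- Expansion of an operator in the Pauli basis. -/
theorem sum_trace_mul_pauli_smul (E : Op n) :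
    ∑ a, (E * pauli a).trace • pauli a = (2 ^ n : ℂ) • E := by
  ext z w
  have h (a : PauliIdx n) : ((E * pauli a).trace • pauli a) z w
      = ∑ x, ∑ y, E x y * (pauli a y x * pauli a z w) := by
    simp only [Matrix.smul_apply, smul_eq_mul, Matrix.trace, Matrix.diag, Matrix.mul_apply,
      Finset.sum_mul, mul_assoc]
  rw [Matrix.sum_apply, Finset.sum_congr rfl fun a _ => h a, Finset.sum_comm]
  have h' (x : Fin n → Fin 2) : ∑ a : PauliIdx n, ∑ y, E x y * (pauli a y x * pauli a z w)
      = ∑ y, E x y * if y = w ∧ x = z then 2 ^ n else 0 := by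
    rw [Finset.sum_comm]
    refine Finset.sum_congr rfl fun y _ => ?_
    rw [← Finset.mul_sum, sum_pauli_apply_mul_apply]
  rw [Finset.sum_congr rfl fun x _ => h' x]
  simp [ite_and, mul_comm]

/-- Parseval's identity for the Pauli basis. -/
theorem sum_trace_mul_pauli_sq (E : Op n) :
    ∑ a, (E * pauli a).trace ^ 2 = 2 ^ n * (E * E).trace := by
  have h := congrArg (fun M => (E * M).trace) (sum_trace_mul_pauli_smul E)
  simp only [Finset.mul_sum, Matrix.trace_sum, Matrix.mul_smul, Matrix.trace_smul,
    smul_eq_mul] at h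
  simpa only [sq] using h

/-! ### Positive operators -/

theorem PosSemidef.trace_mul_nonneg {E ρ : Op n} (hE : E.PosSemidef) (hρ : ρ.PosSemidef) :
    0 ≤ (E * ρ).trace := by
  obtain ⟨B, rfl⟩ := CStarAlgebra.nonneg_iff_eq_star_mul_self.mp hρ.nonneg
  rw [Matrix.star_eq_conjTranspose, ← mul_assoc, Matrix.trace_mul_comm, ← mul_assoc]
  exact (hE.mul_mul_conjTranspose_same B).trace_nonneg

/-- As `P_a² = 1`, the operator `1 + P_a` is Hermitian and its square is twice itself. -/
theorem posSemidef_one_add_pauli (a : PauliIdx n) : (1 + pauli a).PosSemidef := by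
  have h : (1 + pauli a) = (1 / 2 : ℂ) • ((1 + pauli a).conjTranspose * (1 + pauli a)) := by
    rw [Matrix.conjTranspose_add, Matrix.conjTranspose_one, pauli_conjTranspose]
    simp only [mul_add, add_mul, one_mul, mul_one, pauli_mul_self]
    module
  rw [h]
  exact (Matrix.posSemidef_conjTranspose_mul_self _).smul (by norm_num [Complex.le_def])

theorem posSemidef_one_sub_pauli (a : PauliIdx n) : (1 - pauli a).PosSemidef := by
  have h : (1 - pauli a) = (1 / 2 : ℂ) • ((1 - pauli a).conjTranspose * (1 - pauli a)) := by
    rw [Matrix.conjTranspose_sub, Matrix.conjTranspose_one, pauli_conjTranspose]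
    simp only [mul_sub, sub_mul, one_mul, mul_one, pauli_mul_self]
    module
  rw [h]
  exact (Matrix.posSemidef_conjTranspose_mul_self _).smul (by norm_num [Complex.le_def])

theorem PosSemidef.abs_trace_mul_pauli_le {E : Op n} (hE : E.PosSemidef) (a : PauliIdx n) :
    |(E * pauli a).trace.re| ≤ E.trace.re := by
  have h₁ := (Complex.le_def.mp (PosSemidef.trace_mul_nonneg hE (posSemidef_one_add_pauli a))).1
  have h₂ := (Complex.le_def.mp (PosSemidef.trace_mul_nonneg hE (posSemidef_one_sub_pauli a))).1
  simp only [mul_add, mul_sub, mul_one, Matrix.trace_add, Matrix.trace_sub, Complex.add_re,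
    Complex.sub_re, Complex.zero_re] at h₁ h₂
  rw [abs_le]
  constructor <;> linarith

theorem trace_mul_re_eq {E P : Op n} (hE : E.conjTranspose = E) (hP : P.conjTranspose = P) :
    (E * P).trace = ((E * P).trace.re : ℂ) := by
  have h : star (E * P).trace = (E * P).trace := by
    rw [← Matrix.trace_conjTranspose, Matrix.conjTranspose_mul, hE, hP, Matrix.trace_mul_comm]
  exact (Complex.conj_eq_iff_re.mp h).symm

theorem PosSemidef.trace_re_nonneg {E : Op n} (hE : E.PosSemidef) : 0 ≤ E.trace.re :=
  (Complex.le_def.mp hE.trace_nonneg).1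

/-- The `2 × 2` principal minors give `|E_ij|² ≤ E_ii E_jj`; sum over `i, j`. For `i = j` the minor
is zero and the bound is still valid. -/
theorem PosSemidef.trace_mul_self_le {E : Op n} (hE : E.PosSemidef) :
    (E * E).trace.re ≤ E.trace.re ^ 2 := by
  have hdiag (i) : E i i = ((E i i).re : ℂ) :=
    (Complex.conj_eq_iff_re.mp (hE.1.apply i i)).symm
  have hentry (i j) : (E i j * E j i).re ≤ (E i i).re * (E j j).re := by
    have h := (hE.submatrix ![i, j]).det_nonneg
    rw [Matrix.det_fin_two] at h
    have h := (Complex.le_def.mp h).1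
    simp only [Matrix.submatrix_apply, Matrix.cons_val_zero, Matrix.cons_val_one,
      Complex.zero_re, Complex.sub_re] at h
    rw [hdiag i, hdiag j, ← Complex.ofReal_mul, Complex.ofReal_re] at h
    linarith
  simp only [Matrix.trace, Matrix.diag, Matrix.mul_apply, Complex.re_sum, sq]
  rw [Finset.sum_mul_sum]
  exact Finset.sum_le_sum fun i _ => Finset.sum_le_sum fun j _ => hentry i j

theorem PosSemidef.sum_trace_mul_pauli_sq_le {E : Op n} (hE : E.PosSemidef) :
    ∑ a, (E * pauli a).trace.re ^ 2 ≤ 2 ^ n * E.trace.re ^ 2 := by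
  have h := congrArg Complex.re (sum_trace_mul_pauli_sq E)
  rw [Complex.re_sum] at h
  have h₂ : ((2 : ℂ) ^ n * (E * E).trace).re = 2 ^ n * (E * E).trace.re := by
    rw [show (2 : ℂ) ^ n = ((2 ^ n : ℝ) : ℂ) by push_cast; rfl, Complex.re_ofReal_mul]
  have h₁ (a : PauliIdx n) : ((E * pauli a).trace ^ 2).re = (E * pauli a).trace.re ^ 2 := by
    rw [trace_mul_re_eq hE.1 (pauli_conjTranspose a), ← Complex.ofReal_pow, Complex.ofReal_re,
      Complex.ofReal_re]
  rw [Finset.sum_congr rfl fun a _ => h₁ a, h₂] at h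
  rw [h]
  exact mul_le_mul_of_nonneg_left (PosSemidef.trace_mul_self_le hE) (by positivity)

/-! ### Pauli channels -/

theorem pauliMap_posSemidef {p : PauliIdx n → ℝ} (hp : ∀ a, 0 ≤ p a) {ρ : Op n}
    (hρ : ρ.PosSemidef) : (pauliMap p ρ).PosSemidef := by
  refine Matrix.posSemidef_sum _ fun a _ => ?_
  have h := hρ.mul_mul_conjTranspose_same (pauli a)
  rw [pauli_conjTranspose] at h
  exact h.smul (by exact_mod_cast hp a)

theorem trace_pauliMap {p : PauliIdx n → ℝ} (hp : ∑ a, p a = 1) (ρ : Op n) :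
    (pauliMap p ρ).trace = ρ.trace := by
  have h (a : PauliIdx n) : (pauli a * ρ * pauli a).trace = ρ.trace := by
    rw [Matrix.trace_mul_comm, ← mul_assoc, pauli_mul_self, one_mul]
  simp only [pauliMap, Matrix.trace_sum, Matrix.trace_smul, h, ← Finset.sum_smul]
  rw [← Complex.ofReal_sum, hp]
  simp

theorem IsPauliChannel.posSemidef {Λ : Op n → Op n} (hΛ : IsPauliChannel Λ) {ρ : Op n}
    (hρ : ρ.PosSemidef) : (Λ ρ).PosSemidef := by
  obtain ⟨p, hp, rfl⟩ := hΛ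
  exact pauliMap_posSemidef hp.1 hρ

theorem IsPauliChannel.trace {Λ : Op n → Op n} (hΛ : IsPauliChannel Λ) (ρ : Op n) :
    (Λ ρ).trace = ρ.trace := by
  obtain ⟨p, hp, rfl⟩ := hΛ
  exact trace_pauliMap hp.2 ρ

/-- The channel `ρ ↦ 2⁻ⁿ (Tr[ρ] 1 + θ Tr[P_a ρ] P_a)`: for `a ≠ 0` its only Pauli eigenvalue
other than `λ_0 = 1` that does not vanish is `λ_a = θ`. -/
def spikeChannel (a : PauliIdx n) (θ : ℝ) (ρ : Op n) : Op n :=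
  (2 ^ n : ℂ)⁻¹ • (ρ.trace • (1 : Op n) + ((θ : ℂ) * (ρ * pauli a).trace) • pauli a)

/-- Replacing the signed `P_b` by `P_a P_b P_a` turns the sum into `P_a` times the Pauli twirl of
`P_a ρ`. -/
theorem sum_commSign_smul (a : PauliIdx n) (ρ : Op n) :
    ∑ b, (commSign a b : ℂ) • (pauli b * ρ * pauli b)
      = (2 ^ n * (ρ * pauli a).trace) • pauli a := by
  have h (b : PauliIdx n) : (commSign a b : ℂ) • (pauli b * ρ * pauli b)
      = pauli a * (pauli b * (pauli a * ρ) * pauli b) := by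
    rw [← Matrix.smul_mul, ← Matrix.smul_mul, ← pauli_mul_pauli_mul_pauli]
    simp only [mul_assoc]
  rw [Finset.sum_congr rfl fun b _ => h b, ← Finset.mul_sum, sum_pauli_mul_mul_pauli,
    Matrix.mul_smul, mul_one, Matrix.trace_mul_comm]

theorem sum_commSign {a : PauliIdx n} (ha : a ≠ 0) : ∑ b, commSign a b = 0 := by
  have h := sum_commSign_smul a 1
  simp only [mul_one, pauli_mul_self, one_mul, trace_pauli ha, mul_zero, zero_smul,
    ← Finset.sum_smul] at h
  have h := congrFun (congrFun h 0) 0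
  simp only [Matrix.smul_apply, Matrix.one_apply_eq, smul_eq_mul, mul_one, Matrix.zero_apply] at h
  exact_mod_cast h

theorem card_pauliIdx : Fintype.card (PauliIdx n) = 4 ^ n := by
  simp

/-- The error rates are the symplectic Fourier transform of the eigenvalues. The alternative `θ = 0`
admits `a = 0`, the form in which `depol` is defined. -/
theorem isPauliChannel_spikeChannel {a : PauliIdx n} {θ : ℝ} (ha : a ≠ 0 ∨ θ = 0)
    (hθ : |θ| ≤ 1) : IsPauliChannel (spikeChannel a θ) := by
  refine ⟨fun b => (4 ^ n)⁻¹ * (1 + θ * commSign a b), ⟨fun b => ?_, ?_⟩, ?_⟩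
  · have := abs_le.mp hθ
    refine mul_nonneg (by positivity) ?_
    rcases commSign_eq a b with h | h <;> rw [h] <;> linarith
  · have h0 : θ * ∑ b, commSign a b = 0 := by
      rcases ha with ha | rfl
      · rw [sum_commSign ha, mul_zero]
      · rw [zero_mul]
    rw [← Finset.mul_sum, Finset.sum_add_distrib, ← Finset.mul_sum, h0,
      Finset.sum_const, Finset.card_univ, card_pauliIdx]
    simp
  · funext ρ
    have h (b : PauliIdx n) :
        (((4 ^ n)⁻¹ * (1 + θ * commSign a b) : ℝ) : ℂ) • (pauli b * ρ * pauli b)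
          = ((4 ^ n)⁻¹ : ℂ) • (pauli b * ρ * pauli b)
            + ((4 ^ n)⁻¹ * θ : ℂ) • (commSign a b : ℂ) • (pauli b * ρ * pauli b) := by
      push_cast
      module
    rw [pauliMap, Finset.sum_congr rfl fun b _ => h b, Finset.sum_add_distrib,
      ← Finset.smul_sum, ← Finset.smul_sum, sum_commSign_smul, sum_pauli_mul_mul_pauli,
      spikeChannel, smul_add, smul_smul, smul_smul, smul_smul, smul_smul]
    have h4' : (4 : ℂ) ^ n = 2 ^ n * 2 ^ n := by rw [← mul_pow]; norm_num
    have h2 : (2 : ℂ) ^ n ≠ 0 := by positivity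
    congr 2
    · rw [h4']; field_simp
    · rw [h4']; field_simp

theorem pauliEigenvalue_spikeChannel {a : PauliIdx n} (ha : a ≠ 0) (θ : ℝ) :
    pauliEigenvalue (spikeChannel a θ) a = θ := by
  have h2 : (2 : ℂ) ^ n ≠ 0 := by positivity
  have h : spikeChannel a θ (pauli a) = (θ : ℂ) • pauli a := by
    rw [spikeChannel, trace_pauli ha, pauli_mul_self, trace_one_op, zero_smul, zero_add, smul_smul]
    congr 1
    field_simp
  rw [pauliEigenvalue, h, Matrix.mul_smul, pauli_mul_self, Matrix.trace_smul, trace_one_op,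
    smul_eq_mul, mul_div_assoc, div_self h2, mul_one, Complex.ofReal_re]

theorem trace_mul_spikeChannel_re {E ρ : Op n} (hE : E.conjTranspose = E)
    (hρ : ρ.conjTranspose = ρ) (a : PauliIdx n) (θ : ℝ) :
    (E * spikeChannel a θ ρ).trace.re = (2 ^ n)⁻¹ * (E.trace.re * ρ.trace.re
      + θ * (ρ * pauli a).trace.re * (E * pauli a).trace.re) := by
  have h₁ := trace_mul_re_eq hE (pauli_conjTranspose a)
  have h₂ := trace_mul_re_eq hρ (pauli_conjTranspose a)
  have h₃ := trace_mul_re_eq hE (P := 1) (by simp)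
  have h₄ := trace_mul_re_eq hρ (P := 1) (by simp)
  rw [mul_one] at h₃ h₄
  have h : (E * spikeChannel a θ ρ).trace = (((2 ^ n)⁻¹ * (E.trace.re * ρ.trace.re
      + θ * (ρ * pauli a).trace.re * (E * pauli a).trace.re) : ℝ) : ℂ) := by
    push_cast
    rw [← h₁, ← h₂, ← h₃, ← h₄]
    simp only [spikeChannel, Matrix.mul_smul, mul_add, Matrix.trace_smul, Matrix.trace_add,
      smul_eq_mul, mul_one]
    ring
  rw [h, Complex.ofReal_re]

/-! ### Effects of completely positive maps -/

/-- The effect `C†(1)` of a completely positive map `C`, determined by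
`Tr[C†(1) ρ] = Tr[C(ρ)]`. -/
def effect (C : Op n →CP Op n) : Op n :=
  Matrix.of fun i j => (C (Matrix.single j i 1)).trace

theorem trace_effect_mul (C : Op n →CP Op n) (ρ : Op n) :
    (effect C * ρ).trace = (C ρ).trace := by
  conv_rhs => rw [Matrix.matrix_eq_sum_single ρ]
  simp only [map_sum, Matrix.trace_sum]
  rw [Finset.sum_comm]
  simp only [Matrix.trace, Matrix.diag, Matrix.mul_apply, effect, Matrix.of_apply]
  refine Finset.sum_congr rfl fun i _ => Finset.sum_congr rfl fun j _ => ?_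
  have h : Matrix.single j i (ρ j i) = ρ j i • (Matrix.single j i 1 : Op n) := by
    rw [Matrix.smul_single, smul_eq_mul, mul_one]
  rw [h, map_smul]
  simp [mul_comm, Finset.mul_sum]

theorem CompletelyPositiveMap.posSemidef (C : Op n →CP Op n) {ρ : Op n} (hρ : ρ.PosSemidef) :
    (C ρ).PosSemidef := by
  have h : C 0 ≤ C ρ := OrderHomClass.mono C hρ.nonneg
  rw [map_zero] at h
  exact Matrix.nonneg_iff_posSemidef.mp h

theorem effect_posSemidef (C : Op n →CP Op n) : (effect C).PosSemidef := by
  have h (v : (Fin n → Fin 2) → ℂ) : 0 ≤ star v ⬝ᵥ (effect C).mulVec v := by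
    have h₁ := (CompletelyPositiveMap.posSemidef C
      (Matrix.posSemidef_vecMulVec_self_star v)).trace_nonneg
    rw [← trace_effect_mul, Matrix.mul_vecMulVec, Matrix.trace_vecMulVec, dotProduct_comm] at h₁
    exact h₁
  refine .of_dotProduct_mulVec_nonneg ?_ h
  ext i j
  simp only [Matrix.conjTranspose_apply, effect, Matrix.of_apply]
  rw [← Matrix.trace_conjTranspose, ← Matrix.star_eq_conjTranspose, ← map_star,
    Matrix.star_eq_conjTranspose, Matrix.conjTranspose_single, star_one]

theorem ext_trace_mul {E F : Op n} (h : ∀ ρ, (E * ρ).trace = (F * ρ).trace) : E = F :=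
  Matrix.ext_iff_trace_mul_right.mpr h

/-- The law of the next register sees an instrument only through its effects, so one estimate for
POVMs serves the intermediate rounds and the final measurement alike. -/
theorem IsInstrument.isPOVM_effect {A : Type} [Fintype A] {C : A → (Op n →CP Op n)}
    (hC : IsInstrument C) : IsPOVM fun o => effect (C o) := by
  refine ⟨fun o => effect_posSemidef _, ext_trace_mul fun ρ => ?_⟩
  rw [Finset.sum_mul, Matrix.trace_sum, one_mul]
  simp only [trace_effect_mul]
  exact hC ρ

theorem IsTrivialInstrument.isTrivialPOVM_effect {A : Type} {C : A → (Op n →CP Op n)}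
    (hC : IsTrivialInstrument C) : IsTrivialPOVM fun o => effect (C o) := by
  intro o
  obtain ⟨c, Φ, hΦ, h⟩ := hC o
  refine ⟨c, ext_trace_mul fun ρ => ?_⟩
  rw [trace_effect_mul, h, Matrix.trace_smul, hΦ, Matrix.smul_mul, one_mul, Matrix.trace_smul]

/-! ### Information gained by one measurement -/

/-- A bound on the information that the POVM `E`, applied to the output of a channel
`spikeChannel a θ`, gives about `θ`, in units of `θ²`. -/
def povmInfo {A : Type} [Fintype A] (E : A → Op n) (a : PauliIdx n) : ℝ :=
  ∑ o, (2 ^ n)⁻¹ * ((E o * pauli a).trace.re ^ 2 / (E o).trace.re)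

theorem IsPOVM.sum_trace_re {A : Type} [Fintype A] {E : A → Op n} (hE : IsPOVM E) :
    ∑ o, (E o).trace.re = 2 ^ n := by
  rw [← Complex.re_sum, ← Matrix.trace_sum, hE.2, trace_one_op]
  exact_mod_cast Complex.ofReal_re (2 ^ n)

theorem IsPOVM.sum_trace_mul_re {A : Type} [Fintype A] {E : A → Op n} (hE : IsPOVM E) (ρ : Op n) :
    ∑ o, (E o * ρ).trace.re = ρ.trace.re := by
  rw [← Complex.re_sum, ← Matrix.trace_sum, ← Finset.sum_mul, hE.2, one_mul]

/-- Each outcome contributes at most `Tr E_o` to the sum over all labels, and these traces sum to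
`2^n`. Outcomes with `Tr E_o = 0` contribute zero because division by zero gives zero. -/
theorem IsPOVM.sum_povmInfo_le {A : Type} [Fintype A] {E : A → Op n} (hE : IsPOVM E)
    (s : Finset (PauliIdx n)) : ∑ a ∈ s, povmInfo E a ≤ 2 ^ n := by
  have hnn (o : A) := PosSemidef.trace_re_nonneg (hE.1 o)
  have h (o : A) : ∑ a : PauliIdx n, (2 ^ n)⁻¹ * ((E o * pauli a).trace.re ^ 2 / (E o).trace.re)
      ≤ (E o).trace.re := by
    rw [← Finset.mul_sum, ← Finset.sum_div, inv_mul_le_iff₀ (by positivity)]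
    refine div_le_of_le_mul₀ (hnn o) (mul_nonneg (by positivity) (hnn o)) ?_
    rw [mul_assoc, ← sq]
    exact PosSemidef.sum_trace_mul_pauli_sq_le (hE.1 o)
  calc ∑ a ∈ s, povmInfo E a ≤ ∑ a, povmInfo E a :=
        Finset.sum_le_univ_sum_of_nonneg fun a => Finset.sum_nonneg fun o _ =>
          mul_nonneg (by positivity) (div_nonneg (sq_nonneg _) (hnn o))
    _ ≤ ∑ o, (E o).trace.re := by
        simp only [povmInfo]
        rw [Finset.sum_comm]
        exact Finset.sum_le_sum fun o _ => h o
    _ = 2 ^ n := hE.sum_trace_re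

theorem IsTrivialPOVM.povmInfo_eq_zero {A : Type} [Fintype A] {E : A → Op n}
    (hE : IsTrivialPOVM E) {a : PauliIdx n} (ha : a ≠ 0) : povmInfo E a = 0 := by
  refine Finset.sum_eq_zero fun o _ => ?_
  obtain ⟨c, hc⟩ := hE o
  rw [hc, Matrix.smul_mul, one_mul, Matrix.trace_smul, trace_pauli ha]
  simp

theorem sub_sq_le_log_one_add {x : ℝ} (hx : |x| ≤ 1 / 3) : x - x ^ 2 ≤ Real.log (1 + x) := by
  have h := (abs_le.mp (Real.abs_log_sub_add_sum_range_le (x := -x)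
    (by rw [abs_neg]; linarith) 2)).1
  rw [abs_neg, sub_neg_eq_add, Finset.sum_range_succ, Finset.sum_range_one] at h
  -- The Taylor remainder absorbs the second half of `x²`. This is where `|x| ≤ 1/3`, and ultimately
  -- `ε ≤ 1/6`, is needed.
  have h₁ : |x| ^ (2 + 1) / (1 - |x|) ≤ x ^ 2 / 2 := by
    rw [div_le_div_iff₀ (by linarith) (by norm_num), ← sq_abs x]
    have h₂ := mul_nonneg (sq_nonneg |x|) (show 0 ≤ 1 - 3 * |x| by linarith)
    have h₃ : |x| ^ 2 * (1 - 3 * |x|) = |x| ^ 2 * (1 - |x|) - |x| ^ (2 + 1) * 2 := by ring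
    exact sub_nonneg.mp (h₃ ▸ h₂)
  norm_num at h
  linarith

/-- One step of the chain rule for the relative entropy: `u` and `σ.trace` are the probabilities of
the history so far under the channels `spikeChannel a 0` and `spikeChannel a θ`. -/
theorem relEntropy_step {A : Type} [Fintype A] {E : A → Op n} (hE : IsPOVM E) {a : PauliIdx n}
    (ha : a ≠ 0) {θ : ℝ} (hθ : |θ| ≤ 1 / 3) {σ : Op n} (hσ : σ.PosSemidef) {u : ℝ} (hu : 0 ≤ u)
    (huσ : 0 < u → 0 < σ.trace.re) :
    (∀ o, 0 < (2 ^ n)⁻¹ * ((E o).trace.re * u) → 0 < (E o * spikeChannel a θ σ).trace.re) ∧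
    ∑ o, (2 ^ n)⁻¹ * ((E o).trace.re * u) *
        Real.log ((2 ^ n)⁻¹ * ((E o).trace.re * u) / (E o * spikeChannel a θ σ).trace.re)
      ≤ u * Real.log (u / σ.trace.re) + θ ^ 2 * (u * povmInfo E a) := by
  rcases hu.eq_or_lt with rfl | hu
  · simp
  have hσ0 := huσ hu
  set r := (σ * pauli a).trace.re / σ.trace.re with hr
  have hr1 : |r| ≤ 1 := by
    rw [hr, abs_div, abs_of_pos hσ0, div_le_one hσ0]
    exact PosSemidef.abs_trace_mul_pauli_le hσ a
  set y : A → ℝ := fun o => (E o * pauli a).trace.re / (E o).trace.re with hy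
  have hy1 (o : A) : |y o| ≤ 1 := by
    simp only [hy]
    rw [abs_div, abs_of_nonneg (PosSemidef.trace_re_nonneg (hE.1 o))]
    exact div_le_one_of_le₀ (PosSemidef.abs_trace_mul_pauli_le (hE.1 o) a)
      (PosSemidef.trace_re_nonneg (hE.1 o))
  have hEy (o : A) : (E o * pauli a).trace.re = (E o).trace.re * y o := by
    rcases (PosSemidef.trace_re_nonneg (hE.1 o)).eq_or_lt with h | h
    · have := PosSemidef.abs_trace_mul_pauli_le (hE.1 o) a
      rw [← h, abs_nonpos_iff] at this
      rw [this, ← h, zero_mul]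
    · simp only [hy]
      rw [mul_div_cancel₀ _ h.ne']
  have hx (o : A) : |θ * r * y o| ≤ 1 / 3 := by
    rw [abs_mul, abs_mul]
    calc |θ| * |r| * |y o| ≤ 1 / 3 * 1 * 1 := by gcongr; exact hy1 o
      _ = 1 / 3 := by norm_num
  -- The outcome probability factors into the depolarized one and a correction in which the state
  -- appears only as the scalar `r`.
  have hv (o : A) : (E o * spikeChannel a θ σ).trace.re
      = (2 ^ n)⁻¹ * ((E o).trace.re * σ.trace.re) * (1 + θ * r * y o) := by
    rw [trace_mul_spikeChannel_re (hE.1 o).1 hσ.1, hEy]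
    have : (σ * pauli a).trace.re = r * σ.trace.re := by
      rw [hr, div_mul_cancel₀ _ hσ0.ne']
    rw [this]
    ring
  have h2 : (0 : ℝ) < (2 ^ n)⁻¹ := by positivity
  have h1x (o : A) : 0 < 1 + θ * r * y o := by
    have := (abs_le.mp (hx o)).1
    linarith
  constructor
  · intro o ho
    rw [hv]
    have hEo : 0 < (E o).trace.re := pos_of_mul_pos_left (pos_of_mul_pos_right ho h2.le) hu.le
    exact mul_pos (mul_pos h2 (mul_pos hEo hσ0)) (h1x o)
  have hterm (o : A) : (2 ^ n)⁻¹ * ((E o).trace.re * u) *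
      Real.log ((2 ^ n)⁻¹ * ((E o).trace.re * u) / (E o * spikeChannel a θ σ).trace.re)
      ≤ (E o).trace.re * ((2 ^ n)⁻¹ * (u * Real.log (u / σ.trace.re)))
        - (2 ^ n)⁻¹ * u * θ * r * (E o * pauli a).trace.re
        + θ ^ 2 * (u * ((2 ^ n)⁻¹ * ((E o * pauli a).trace.re ^ 2 / (E o).trace.re))) := by
    rcases (PosSemidef.trace_re_nonneg (hE.1 o)).eq_or_lt with h | h
    · rw [hEy, ← h]
      simp
    have hquot : (2 ^ n)⁻¹ * ((E o).trace.re * u) / (E o * spikeChannel a θ σ).trace.re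
        = u / σ.trace.re / (1 + θ * r * y o) := by
      rw [hv]
      have := (h1x o).ne'
      field_simp
    have hlog := sub_sq_le_log_one_add (hx o)
    have hr2 : (θ * r * y o) ^ 2 ≤ θ ^ 2 * y o ^ 2 := by
      rw [mul_pow, mul_pow]
      have : r ^ 2 ≤ 1 := (sq_le_one_iff_abs_le_one r).mpr hr1
      nlinarith [mul_nonneg (sq_nonneg θ) (sq_nonneg (y o))]
    have hy2 : (E o * pauli a).trace.re ^ 2 / (E o).trace.re = (E o).trace.re * y o ^ 2 := by
      rw [hEy]
      field_simp
    rw [hquot, Real.log_div (div_pos hu hσ0).ne' (h1x o).ne', hy2, hEy]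
    have hpos : 0 < (2 ^ n)⁻¹ * ((E o).trace.re * u) := mul_pos h2 (mul_pos h hu)
    have := mul_le_mul_of_nonneg_left (show Real.log (u / σ.trace.re) - Real.log (1 + θ * r * y o)
      ≤ Real.log (u / σ.trace.re) - θ * r * y o + θ ^ 2 * y o ^ 2 by linarith) hpos.le
    refine this.trans (le_of_eq ?_)
    ring
  -- The first-order term in `θ` cancels over the outcomes, as `P_a` is traceless; only the order
  -- `θ²` survives.
  have hlin : ∑ o, (E o * pauli a).trace.re = 0 := by
    rw [← Complex.re_sum, ← Matrix.trace_sum, ← Finset.sum_mul, hE.2, one_mul, trace_pauli ha,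
      Complex.zero_re]
  refine (Finset.sum_le_sum fun o _ => hterm o).trans (le_of_eq ?_)
  rw [Finset.sum_add_distrib, Finset.sum_sub_distrib, ← Finset.sum_mul, hE.sum_trace_re,
    ← Finset.mul_sum, hlin, ← Finset.mul_sum, ← Finset.mul_sum, povmInfo]
  field_simp
  ring

/-! ### Relative entropy and total variation, through the Hellinger distance. -/

/-- Relative entropy dominates the squared total variation distance. -/
theorem sq_sub_le_relEntropy {Ω : Type} [Fintype Ω] {p q : Ω → ℝ} (hp : ∀ o, 0 ≤ p o)
    (hq : ∀ o, 0 ≤ q o) (hp1 : ∑ o, p o = 1) (hq1 : ∑ o, q o = 1)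
    (hpq : ∀ o, 0 < p o → 0 < q o) (G : Finset Ω) :
    (∑ o ∈ G, p o - ∑ o ∈ G, q o) ^ 2 ≤ ∑ o, p o * Real.log (p o / q o) := by
  classical
  set s : Ω → ℝ := fun o => Real.sqrt (p o) with hs
  set t : Ω → ℝ := fun o => Real.sqrt (q o) with ht
  have hsq (o : Ω) : s o ^ 2 = p o := Real.sq_sqrt (hp o)
  have htq (o : Ω) : t o ^ 2 = q o := Real.sq_sqrt (hq o)
  -- This is `log x ≤ x - 1` at `x = √(q/p)`; summed, it bounds the squared Hellinger distance `∑ (s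
  -- - t)²` by the relative entropy.
  have hterm (o : Ω) : 2 * p o - 2 * (s o * t o) ≤ p o * Real.log (p o / q o) := by
    rcases (hp o).eq_or_lt with h | h
    · simp [hs, ← h]
    · have h' := hpq o h
      have hs0 : 0 < s o := Real.sqrt_pos.mpr h
      have ht0 : 0 < t o := Real.sqrt_pos.mpr h'
      have hl := Real.log_le_sub_one_of_pos (div_pos ht0 hs0)
      have e : p o / q o = ((t o / s o) ^ 2)⁻¹ := by
        rw [← hsq, ← htq, div_pow, inv_div]
      rw [e, Real.log_inv, Real.log_pow]
      have e2 : 2 * p o - 2 * (s o * t o) = p o * (-(2 * (t o / s o - 1))) := by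
        rw [← hsq]
        field_simp
        ring
      rw [e2]
      push_cast
      exact mul_le_mul_of_nonneg_left (by linarith) h.le
  have hsum : ∑ o, (s o - t o) ^ 2 = ∑ o, (2 * p o - 2 * (s o * t o)) := by
    have (o : Ω) : (s o - t o) ^ 2 = (2 * p o - 2 * (s o * t o)) + (q o - p o) := by
      rw [← hsq, ← htq]; ring
    rw [Finset.sum_congr rfl fun o _ => this o, Finset.sum_add_distrib, Finset.sum_sub_distrib q,
      hp1, hq1]
    ring
  have hplus : ∑ o, (s o + t o) ^ 2 ≤ 4 := by
    have (o : Ω) : (s o + t o) ^ 2 ≤ 2 * p o + 2 * q o := by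
      rw [← hsq, ← htq]; nlinarith [sq_nonneg (s o - t o)]
    refine (Finset.sum_le_sum fun o _ => this o).trans ?_
    rw [Finset.sum_add_distrib, ← Finset.mul_sum, ← Finset.mul_sum, hp1, hq1]
    norm_num
  -- As `p - q` has total mass zero, weighting it with these signs gives twice its mass on `G`; the
  -- signs vanish on squaring in Cauchy–Schwarz.
  set e : Ω → ℝ := fun o => if o ∈ G then 1 else -1 with he
  have hdiff : 2 * (∑ o ∈ G, p o - ∑ o ∈ G, q o) = ∑ o, (s o - t o) * (e o * (s o + t o)) := by
    have (o : Ω) : (s o - t o) * (e o * (s o + t o))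
        = 2 * ((if o ∈ G then p o else 0) - if o ∈ G then q o else 0) - (p o - q o) := by
      simp only [he]
      rw [← hsq, ← htq]
      split_ifs <;> ring
    rw [Finset.sum_congr rfl fun o _ => this o, Finset.sum_sub_distrib, Finset.sum_sub_distrib p,
      hp1, hq1, ← Finset.mul_sum, Finset.sum_sub_distrib, Finset.sum_ite_mem, Finset.sum_ite_mem]
    simp
  have hCS := Finset.sum_mul_sq_le_sq_mul_sq Finset.univ (fun o => s o - t o)
    fun o => e o * (s o + t o)
  have he2 (o : Ω) : (e o * (s o + t o)) ^ 2 = (s o + t o) ^ 2 := by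
    simp only [he]
    split_ifs <;> ring
  simp only [he2] at hCS
  rw [← hdiff] at hCS
  have hnn : 0 ≤ ∑ o, (s o - t o) ^ 2 := Finset.sum_nonneg fun o _ => sq_nonneg _
  have hKL : ∑ o, (s o - t o) ^ 2 ≤ ∑ o, p o * Real.log (p o / q o) :=
    hsum.trans_le (Finset.sum_le_sum fun o _ => hterm o)
  nlinarith [mul_le_mul_of_nonneg_left hplus hnn]

variable {m : ℕ}

/-! ### Histories -/

/-- Append the content of one more register to a history. -/
def Hist.snoc {A : ℕ → Type} {t : ℕ} (h : Hist A t) (o : A t) : Hist A (t + 1) :=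
  Fin.snoc (α := fun k : Fin (t + 1) => A k) h o

theorem Hist.snoc_castSucc {A : ℕ → Type} {t : ℕ} (h : Hist A t) (o : A t) :
    (fun k : Fin t => h.snoc o k.castSucc) = h := by
  funext k
  exact Fin.snoc_castSucc (α := fun k : Fin (t + 1) => A k) o h k

theorem Hist.snoc_last {A : ℕ → Type} {t : ℕ} (h : Hist A t) (o : A t) :
    h.snoc o (Fin.last t) = o :=
  Fin.snoc_last (α := fun k : Fin (t + 1) => A k) o h

theorem Hist.snoc_surjective {A : ℕ → Type} {t : ℕ} (h : Hist A (t + 1)) :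
    ∃ (h' : Hist A t) (o : A t), h = h'.snoc o :=
  ⟨fun k => h k.castSucc, h (Fin.last t),
    (Fin.snoc_init_self (α := fun k : Fin (t + 1) => A k) h).symm⟩

theorem Hist.sum_succ {A : ℕ → Type} [∀ t, Fintype (A t)] {t : ℕ} (f : Hist A (t + 1) → ℝ) :
    ∑ h, f h = ∑ h : Hist A t, ∑ o, f (h.snoc o) := by
  rw [← Fintype.sum_prod_type', ← (Equiv.prodComm _ _).sum_comp,
    ← (Fin.snocEquiv fun k : Fin (t + 1) => A k).sum_comp]
  rfl

/-! ### Completely depolarizing reference channel -/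

/-- The completely depolarizing channel. -/
def depol (n : ℕ) : Op n → Op n := spikeChannel 0 0

theorem isPauliChannel_depol : IsPauliChannel (depol n) :=
  isPauliChannel_spikeChannel (Or.inr rfl) (by simp)

theorem trace_mul_depol_re {E ρ : Op n} (hE : E.conjTranspose = E) (hρ : ρ.conjTranspose = ρ) :
    (E * depol n ρ).trace.re = (2 ^ n)⁻¹ * (E.trace.re * ρ.trace.re) := by
  rw [depol, trace_mul_spikeChannel_re hE hρ]
  ring

/-- Chain rule for one round of measurements, summed over all non-identity Paulis. -/
theorem sum_relEntropy_round {H A : Type} [Fintype H] [Fintype A] {E : H → A → Op n}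
    (hE : ∀ h, IsPOVM (E h)) {θ : ℝ} (hθ : |θ| ≤ 1 / 3) {σ₀ : H → Op n}
    {σ : PauliIdx n → H → Op n} (hσ₀ : ∀ h, (σ₀ h).PosSemidef)
    (hσ : ∀ a ≠ 0, ∀ h, (σ a h).PosSemidef)
    (hpos : ∀ a ≠ 0, ∀ h, 0 < (σ₀ h).trace.re → 0 < (σ a h).trace.re)
    {c : H → ℕ} (hc : ∀ h, IsTrivialPOVM (E h) ∨ c h = 1) :
    ∑ a ∈ Finset.univ.erase (0 : PauliIdx n), ∑ h, ∑ o, (E h o * depol n (σ₀ h)).trace.re *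
        Real.log ((E h o * depol n (σ₀ h)).trace.re /
          (E h o * spikeChannel a θ (σ a h)).trace.re)
      ≤ ∑ a ∈ Finset.univ.erase (0 : PauliIdx n), ∑ h, (σ₀ h).trace.re *
          Real.log ((σ₀ h).trace.re / (σ a h).trace.re)
        + θ ^ 2 * 2 ^ n * ∑ h, (σ₀ h).trace.re * c h := by
  have h₁ : ∀ a ∈ Finset.univ.erase (0 : PauliIdx n), ∑ h, ∑ o,
      (E h o * depol n (σ₀ h)).trace.re * Real.log ((E h o * depol n (σ₀ h)).trace.re /
          (E h o * spikeChannel a θ (σ a h)).trace.re)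
      ≤ ∑ h, ((σ₀ h).trace.re * Real.log ((σ₀ h).trace.re / (σ a h).trace.re)
        + θ ^ 2 * ((σ₀ h).trace.re * povmInfo (E h) a)) := by
    intro a ha
    have ha := Finset.ne_of_mem_erase ha
    refine Finset.sum_le_sum fun h _ => ?_
    simp only [trace_mul_depol_re ((hE h).1 _).1 (hσ₀ h).1]
    exact (relEntropy_step (hE h) ha hθ (hσ a ha h) (PosSemidef.trace_re_nonneg (hσ₀ h))
      (hpos a ha h)).2
  refine (Finset.sum_le_sum h₁).trans ?_
  simp only [Finset.sum_add_distrib]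
  gcongr
  -- Neither the weight of `h` under the reference channel nor the POVM chosen after `h` depends on
  -- `a`, so the labels can be summed for each history separately.
  rw [Finset.sum_comm, Finset.mul_sum]
  refine Finset.sum_le_sum fun h _ => ?_
  rw [← Finset.mul_sum, ← Finset.mul_sum, mul_assoc]
  refine mul_le_mul_of_nonneg_left ?_ (sq_nonneg θ)
  rw [mul_left_comm]
  refine mul_le_mul_of_nonneg_left ?_ (PosSemidef.trace_re_nonneg (hσ₀ h))
  rcases hc h with htriv | h1
  · rw [Finset.sum_eq_zero fun a ha => htriv.povmInfo_eq_zero (Finset.ne_of_mem_erase ha)]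
    positivity
  · rw [h1, Nat.cast_one, mul_one]
    exact (hE h).sum_povmInfo_le _

/-! ### Relative entropy accumulated along a scheme. -/

namespace Scheme

variable (S : Scheme n m)

theorem state_succ_snoc (Λ : Op n → Op n) (t : ℕ) (h : Hist S.A (t + 1)) (o : S.A (t + 1)) :
    S.state Λ (t + 1) (h.snoc o) = S.instr t h o (Λ (S.state Λ t h)) := by
  rw [state, Hist.snoc_castSucc, Hist.snoc_last]

theorem trace_state_succ_snoc (Λ : Op n → Op n) (t : ℕ) (h : Hist S.A (t + 1))
    (o : S.A (t + 1)) :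
    (S.state Λ (t + 1) (h.snoc o)).trace = (effect (S.instr t h o) * Λ (S.state Λ t h)).trace := by
  rw [state_succ_snoc, trace_effect_mul]

theorem prob_snoc (Λ : Op n → Op n) (h : Hist S.A (m + 1)) (o : S.A (m + 1)) :
    S.prob Λ (h.snoc o) = (S.povm h o * Λ (S.state Λ m h)).trace.re := by
  rw [prob, Hist.snoc_castSucc, Hist.snoc_last]

variable {Λ : Op n → Op n}

theorem state_posSemidef (hΛ : IsPauliChannel Λ) (t : ℕ) (h : Hist S.A (t + 1)) :
    (S.state Λ t h).PosSemidef := by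
  induction t with
  | zero => exact S.init_posSemidef _
  | succ t ih => exact CompletelyPositiveMap.posSemidef _ (hΛ.posSemidef (ih _))

theorem prob_nonneg (hΛ : IsPauliChannel Λ) (o : S.Outcome) : 0 ≤ S.prob Λ o :=
  (Complex.le_def.mp (PosSemidef.trace_mul_nonneg ((S.povm_isPOVM _).1 _)
    (hΛ.posSemidef (S.state_posSemidef hΛ m _)))).1

theorem sum_trace_state (hΛ : IsPauliChannel Λ) {t : ℕ} (ht : t ≤ m) :
    ∑ h, (S.state Λ t h).trace.re = 1 := by
  induction t with
  | zero =>
    have h (o : S.A 0) (h : Hist S.A 0) : S.state Λ 0 (h.snoc o) = S.init o := by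
      rw [state]
      exact congrArg S.init (Hist.snoc_last h o)
    rw [Hist.sum_succ]
    simp only [h]
    rw [Fintype.sum_unique, ← Complex.re_sum, S.init_trace, Complex.one_re]
  | succ t ih =>
    rw [Hist.sum_succ]
    simp only [trace_state_succ_snoc]
    simp only [IsPOVM.sum_trace_mul_re (S.instr_isInstrument t ht _).isPOVM_effect, hΛ.trace]
    exact ih (by omega)

theorem sum_prob (hΛ : IsPauliChannel Λ) : ∑ o, S.prob Λ o = 1 := by
  rw [Hist.sum_succ]
  simp only [prob_snoc, IsPOVM.sum_trace_mul_re (S.povm_isPOVM _), hΛ.trace]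
  exact S.sum_trace_state hΛ le_rfl

open Classical in
/-- The number of non-trivial instruments among the first `t` ones. -/
def instrCount : (t : ℕ) → Hist S.A (t + 1) → ℕ
  | 0, _ => 0
  | t + 1, h => instrCount t (fun k => h k.castSucc) +
      if IsTrivialInstrument (S.instr t fun k => h k.castSucc) then 0 else 1

open Classical in
theorem instrCount_succ_snoc (t : ℕ) (h : Hist S.A (t + 1)) (o : S.A (t + 1)) :
    S.instrCount (t + 1) (h.snoc o)
      = S.instrCount t h + if IsTrivialInstrument (S.instr t h) then 0 else 1 := by
  rw [instrCount, Hist.snoc_castSucc]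

open Classical in
theorem instrCount_eq_sum (t : ℕ) (h : Hist S.A (t + 1)) :
    S.instrCount t h = ∑ s : Fin t, if IsTrivialInstrument
      (S.instr s fun k => h (k.castLE (Nat.succ_le_succ s.isLt.le))) then 0 else 1 := by
  induction t with
  | zero => rfl
  | succ t ih =>
    rw [instrCount, ih, Fin.sum_univ_castSucc]
    rfl

open Classical in
-- Matches the count defined by filtering with the recursive `instrCount`, which suits induction
-- over rounds.
theorem measCount_snoc (h : Hist S.A (m + 1)) (o : S.A (m + 1)) :
    S.measCount (h.snoc o) = S.instrCount m h + if IsTrivialPOVM (S.povm h) then 0 else 1 := by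
  rw [measCount, Hist.snoc_castSucc]
  conv_rhs => rw [← Hist.snoc_castSucc h o, instrCount_eq_sum]
  rw [Hist.snoc_castSucc, Finset.card_filter]
  congr 1
  refine Finset.sum_congr rfl fun s _ => ?_
  rw [ite_not]
  rfl

/-- Absolute continuity. It has to be tracked because `Real.log (p / 0)` is `0`, not infinity. -/
theorem trace_state_pos {θ : ℝ} (hθ : |θ| ≤ 1 / 3) {a : PauliIdx n} (ha : a ≠ 0) {t : ℕ}
    (ht : t ≤ m) (h : Hist S.A (t + 1)) (hpos : 0 < (S.state (depol n) t h).trace.re) :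
    0 < (S.state (spikeChannel a θ) t h).trace.re := by
  have hΛ := isPauliChannel_spikeChannel (Or.inl ha) (hθ.trans (by norm_num))
  induction t with
  | zero =>
    rw [state] at hpos ⊢
    exact hpos
  | succ t ih =>
    obtain ⟨h, o, rfl⟩ := h.snoc_surjective
    rw [trace_state_succ_snoc] at hpos ⊢
    have h₀ := S.state_posSemidef isPauliChannel_depol t h
    rw [trace_mul_depol_re (effect_posSemidef _).1 h₀.1] at hpos
    exact (relEntropy_step (S.instr_isInstrument t ht h).isPOVM_effect ha hθ
      (S.state_posSemidef hΛ t h) (PosSemidef.trace_re_nonneg h₀)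
      (ih (by omega) h)).1 o hpos

theorem prob_pos {θ : ℝ} (hθ : |θ| ≤ 1 / 3) {a : PauliIdx n} (ha : a ≠ 0) (o : S.Outcome)
    (hpos : 0 < S.prob (depol n) o) : 0 < S.prob (spikeChannel a θ) o := by
  have hΛ := isPauliChannel_spikeChannel (Or.inl ha) (hθ.trans (by norm_num))
  obtain ⟨h, o, rfl⟩ := o.snoc_surjective
  rw [prob_snoc] at hpos ⊢
  have h₀ := S.state_posSemidef isPauliChannel_depol m h
  rw [trace_mul_depol_re ((S.povm_isPOVM h).1 o).1 h₀.1] at hpos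
  exact (relEntropy_step (S.povm_isPOVM h) ha hθ (S.state_posSemidef hΛ m h)
    (PosSemidef.trace_re_nonneg h₀) (S.trace_state_pos hθ ha le_rfl h)).1 o hpos

theorem sum_relEntropy_state_le {θ : ℝ} (hθ : |θ| ≤ 1 / 3) {t : ℕ} (ht : t ≤ m) :
    ∑ a ∈ Finset.univ.erase (0 : PauliIdx n), ∑ h, (S.state (depol n) t h).trace.re *
        Real.log ((S.state (depol n) t h).trace.re / (S.state (spikeChannel a θ) t h).trace.re)
      ≤ θ ^ 2 * 2 ^ n * ∑ h, (S.state (depol n) t h).trace.re * S.instrCount t h := by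
  classical
  induction t with
  | zero =>
    simp only [state, instrCount, Nat.cast_zero, mul_zero, Finset.sum_const_zero]
    -- Before the channel is first used, the record has the same law under every channel.
    refine (Finset.sum_eq_zero fun a _ => Finset.sum_eq_zero fun h _ => ?_).le
    rcases eq_or_ne (S.init (h 0)).trace.re 0 with h0 | h0
    · rw [h0, zero_mul]
    · rw [div_self h0, Real.log_one, mul_zero]
  | succ t ih =>
    have hround := sum_relEntropy_round (E := fun h o => effect (S.instr t h o))
      (fun h => (S.instr_isInstrument t ht h).isPOVM_effect) hθ
      (σ₀ := S.state (depol n) t) (σ := fun a => S.state (spikeChannel a θ) t)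
      (fun h => S.state_posSemidef isPauliChannel_depol t h)
      (fun a ha h => S.state_posSemidef
        (isPauliChannel_spikeChannel (Or.inl ha) (hθ.trans (by norm_num))) t h)
      (fun a ha h => S.trace_state_pos hθ ha (by omega) h)
      (c := fun h => if IsTrivialInstrument (S.instr t h) then 0 else 1)
      (fun h => by
        by_cases htriv : IsTrivialInstrument (S.instr t h)
        · exact Or.inl htriv.isTrivialPOVM_effect
        · exact Or.inr (if_neg htriv))
    have hcount : ∑ h, (S.state (depol n) (t + 1) h).trace.re * S.instrCount (t + 1) h
        = ∑ h, (S.state (depol n) t h).trace.re * S.instrCount t h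
          + ∑ h, (S.state (depol n) t h).trace.re *
            ((if IsTrivialInstrument (S.instr t h) then 0 else 1 : ℕ) : ℝ) := by
      rw [Hist.sum_succ, ← Finset.sum_add_distrib]
      refine Finset.sum_congr rfl fun h _ => ?_
      simp only [trace_state_succ_snoc, instrCount_succ_snoc]
      rw [← Finset.sum_mul,
        IsPOVM.sum_trace_mul_re (S.instr_isInstrument t ht h).isPOVM_effect,
        isPauliChannel_depol.trace, Nat.cast_add, mul_add]
    rw [hcount, mul_add]
    simp only [Hist.sum_succ (t := t + 1), trace_state_succ_snoc]
    exact hround.trans (by gcongr; exact ih (by omega))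

theorem sum_relEntropy_prob_le {θ : ℝ} (hθ : |θ| ≤ 1 / 3) :
    ∑ a ∈ Finset.univ.erase (0 : PauliIdx n), ∑ o, S.prob (depol n) o *
        Real.log (S.prob (depol n) o / S.prob (spikeChannel a θ) o)
      ≤ θ ^ 2 * 2 ^ n * ∑ o, S.prob (depol n) o * S.measCount o := by
  classical
  have hround := sum_relEntropy_round S.povm_isPOVM hθ
    (σ₀ := S.state (depol n) m) (σ := fun a => S.state (spikeChannel a θ) m)
    (fun h => S.state_posSemidef isPauliChannel_depol m h)
    (fun a ha h => S.state_posSemidef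
      (isPauliChannel_spikeChannel (Or.inl ha) (hθ.trans (by norm_num))) m h)
    (fun a ha h => S.trace_state_pos hθ ha le_rfl h)
    (c := fun h => if IsTrivialPOVM (S.povm h) then 0 else 1)
    (fun h => by
      by_cases htriv : IsTrivialPOVM (S.povm h)
      · exact Or.inl htriv
      · exact Or.inr (if_neg htriv))
  have hcount : ∑ o, S.prob (depol n) o * S.measCount o
      = ∑ h, (S.state (depol n) m h).trace.re * S.instrCount m h
        + ∑ h, (S.state (depol n) m h).trace.re *
          ((if IsTrivialPOVM (S.povm h) then 0 else 1 : ℕ) : ℝ) := by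
    rw [Hist.sum_succ, ← Finset.sum_add_distrib]
    refine Finset.sum_congr rfl fun h _ => ?_
    simp only [prob_snoc, measCount_snoc]
    rw [← Finset.sum_mul, IsPOVM.sum_trace_mul_re (S.povm_isPOVM h),
      isPauliChannel_depol.trace, Nat.cast_add, mul_add]
  rw [hcount, mul_add]
  simp only [Hist.sum_succ (t := m + 1), prob_snoc]
  exact hround.trans (by gcongr; exact S.sum_relEntropy_state_le hθ le_rfl)

/-- A mean is at most a maximum, and sequences possible under `depol` are among those over which
`numMeas` is taken. -/
theorem sum_prob_mul_measCount_le :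
    ∑ o, S.prob (depol n) o * S.measCount o ≤ S.numMeas := by
  classical
  calc ∑ o, S.prob (depol n) o * S.measCount o ≤ ∑ o, S.prob (depol n) o * S.numMeas := by
        refine Finset.sum_le_sum fun o _ => ?_
        rcases (S.prob_nonneg isPauliChannel_depol o).eq_or_lt with h | h
        · rw [← h, zero_mul, zero_mul]
        · refine mul_le_mul_of_nonneg_left ?_ h.le
          have ho : o ∈ Finset.univ.filter
              fun o : S.Outcome => ∃ Λ, IsPauliChannel Λ ∧ 0 < S.prob Λ o :=
            Finset.mem_filter.mpr ⟨Finset.mem_univ o, _, isPauliChannel_depol, h⟩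
          exact Nat.cast_le.mpr (Finset.le_sup (f := S.measCount) ho)
    _ = S.numMeas := by rw [← Finset.sum_mul, S.sum_prob isPauliChannel_depol, one_mul]

theorem numMeas_le_numCopies : S.numMeas ≤ S.numCopies := by
  classical
  refine Finset.sup_le fun o _ => Nat.add_le_add ?_ (by split_ifs <;> simp)
  exact (Finset.card_filter_le _ _).trans (by simp)

/-! ### Testing the sign of an eigenvalue, and the final bounds. -/

theorem Learns.relEntropy_ge {S : Scheme n m} {est : S.Outcome → PauliIdx n → ℝ} {ε : ℝ}
    (hS : S.Learns est ε) (hε : 0 < ε) (hε' : ε ≤ 1 / 6) {a : PauliIdx n} (ha : a ≠ 0) :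
    1 / 18 ≤ ∑ o, S.prob (depol n) o *
        Real.log (S.prob (depol n) o / S.prob (spikeChannel a (2 * ε)) o)
      + ∑ o, S.prob (depol n) o *
        Real.log (S.prob (depol n) o / S.prob (spikeChannel a (-(2 * ε))) o) := by
  classical
  have hp : |2 * ε| ≤ 1 / 3 := by rw [abs_of_pos (by linarith)]; linarith
  have hm : |-(2 * ε)| ≤ 1 / 3 := by rwa [abs_neg]
  have hΛp := isPauliChannel_spikeChannel (Or.inl ha) (hp.trans (by norm_num))
  have hΛm := isPauliChannel_spikeChannel (Or.inl ha) (hm.trans (by norm_num))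
  have h₀ := S.prob_nonneg isPauliChannel_depol
  have h₁ := S.sum_prob isPauliChannel_depol
  -- An estimate within `ε` of `±2ε` has the correct sign.
  set G : Finset S.Outcome := Finset.univ.filter fun o => 0 ≤ est o a with hG
  have hGp : 2 / 3 ≤ ∑ o ∈ G, S.prob (spikeChannel a (2 * ε)) o := by
    refine (hS _ hΛp a).trans (Finset.sum_le_sum_of_subset_of_nonneg (fun o ho => ?_)
      fun o _ _ => S.prob_nonneg hΛp o)
    rw [Finset.mem_filter, pauliEigenvalue_spikeChannel ha] at ho
    exact Finset.mem_filter.mpr ⟨ho.1, by linarith [(abs_le.mp ho.2).1]⟩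
  have hGm : 2 / 3 ≤ ∑ o ∈ Gᶜ, S.prob (spikeChannel a (-(2 * ε))) o := by
    refine (hS _ hΛm a).trans (Finset.sum_le_sum_of_subset_of_nonneg (fun o ho => ?_)
      fun o _ _ => S.prob_nonneg hΛm o)
    rw [Finset.mem_filter, pauliEigenvalue_spikeChannel ha] at ho
    rw [Finset.mem_compl, hG, Finset.mem_filter, not_and, not_le]
    exact fun _ => by linarith [(abs_le.mp ho.2).2]
  have hsum := Finset.sum_add_sum_compl G (S.prob (spikeChannel a (-(2 * ε))))
  rw [S.sum_prob hΛm] at hsum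
  have hKp := sq_sub_le_relEntropy h₀ (S.prob_nonneg hΛp) h₁ (S.sum_prob hΛp)
    (S.prob_pos hp ha) G
  have hKm := sq_sub_le_relEntropy h₀ (S.prob_nonneg hΛm) h₁ (S.sum_prob hΛm)
    (S.prob_pos hm ha) G
  set g := ∑ o ∈ G, S.prob (depol n) o
  set x := ∑ o ∈ G, S.prob (spikeChannel a (2 * ε)) o
  set y := ∑ o ∈ G, S.prob (spikeChannel a (-(2 * ε))) o
  have hxy : 1 / 3 ≤ x - y := by linarith
  -- `(g - x)² + (g - y)² ≥ (x - y)² / 2 ≥ 1/18`.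
  nlinarith [sq_nonneg ((g - x) + (g - y))]

theorem Learns.numMeas_ge {S : Scheme n m} {est : S.Outcome → PauliIdx n → ℝ} {ε : ℝ}
    (hS : S.Learns est ε) (hε : 0 < ε) (hε' : ε ≤ 1 / 6) :
    0.005 * (((4 : ℝ) ^ n - 1) / (2 ^ n * ε ^ 2)) ≤ S.numMeas := by
  have hp : |2 * ε| ≤ 1 / 3 := by rw [abs_of_pos (by linarith)]; linarith
  have hm : |-(2 * ε)| ≤ 1 / 3 := by rwa [abs_neg]
  have hcard : ((Finset.univ.erase (0 : PauliIdx n)).card : ℝ) = 4 ^ n - 1 := by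
    rw [Finset.card_erase_of_mem (Finset.mem_univ _), Finset.card_univ, card_pauliIdx,
      Nat.cast_sub (Nat.one_le_pow _ _ (by norm_num))]
    simp
  have hlow := Finset.card_nsmul_le_sum (Finset.univ.erase (0 : PauliIdx n)) _ _
    fun a ha => hS.relEntropy_ge hε hε' (Finset.ne_of_mem_erase ha)
  rw [nsmul_eq_mul, hcard, Finset.sum_add_distrib] at hlow
  have hup₁ := S.sum_relEntropy_prob_le hp
  have hup₂ := S.sum_relEntropy_prob_le hm
  have hN : (2 * ε) ^ 2 * 2 ^ n * ∑ o, S.prob (depol n) o * S.measCount o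
      ≤ (2 * ε) ^ 2 * 2 ^ n * S.numMeas :=
    mul_le_mul_of_nonneg_left S.sum_prob_mul_measCount_le (by positivity)
  rw [neg_sq] at hup₂
  have hnn : 0 ≤ 2 ^ n * ε ^ 2 * (S.numMeas : ℝ) := by positivity
  rw [← mul_div_assoc, div_le_iff₀ (by positivity)]
  -- The two signs together give the constant `1 / (18 · 2 · 4) = 1/144`, which exceeds `0.005`.
  nlinarith

end Scheme

end PauliLearning

end

theorem theorem1 :
    (∀ (n m : ℕ) (S : PauliLearning.Scheme n m)
      (est : S.Outcome → PauliLearning.PauliIdx n → ℝ) (ε : ℝ),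
      0 < ε → ε ≤ 1 / 6 → S.Learns est ε →
        0.005 * (((4 : ℝ) ^ n - 1) / (2 ^ n * ε ^ 2)) ≤ (S.numMeas : ℝ) ∧
        S.numMeas ≤ S.numCopies ∧
        0.005 * (((4 : ℝ) ^ n - 1) / (2 ^ n * ε ^ 2)) ≤ (S.numCopies : ℝ)) ∧
    (∃ c : ℝ, 0 < c ∧
      ∀ (n m : ℕ) (S : PauliLearning.Scheme n m)
        (est : S.Outcome → PauliLearning.PauliIdx n → ℝ) (ε : ℝ),
        1 ≤ n → 0 < ε → ε ≤ 1 / 6 → S.Learns est ε →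
          c * (2 ^ n / ε ^ 2) ≤ (S.numMeas : ℝ) ∧
          c * (2 ^ n / ε ^ 2) ≤ (S.numCopies : ℝ)) := by
  have hcopies {n m : ℕ} (S : PauliLearning.Scheme n m) : (S.numMeas : ℝ) ≤ S.numCopies :=
    Nat.cast_le.mpr S.numMeas_le_numCopies
  constructor
  · intro n m S est ε hε hε' hS
    have h := hS.numMeas_ge hε hε'
    exact ⟨h, S.numMeas_le_numCopies, h.trans (hcopies S)⟩
  -- `0.00375 = 0.005 · 3/4`, since `4^n - 1 ≥ (3/4) · 4^n` for `n ≥ 1`.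
  · refine ⟨0.00375, by norm_num, fun n m S est ε hn hε hε' hS => ?_⟩
    have h : 0.00375 * (2 ^ n / ε ^ 2) ≤ (S.numMeas : ℝ) := by
      refine le_trans ?_ (hS.numMeas_ge hε hε')
      have h4 : (4 : ℝ) ^ n = 2 ^ n * 2 ^ n := by rw [← mul_pow]; norm_num
      have h2 : (2 : ℝ) ≤ 2 ^ n := by simpa using pow_le_pow_right₀ (one_le_two (α := ℝ)) hn
      rw [← mul_div_assoc, ← mul_div_assoc, div_le_div_iff₀ (by positivity) (by positivity), h4,
        ← mul_assoc]
      exact mul_le_mul_of_nonneg_right (by nlinarith) (sq_nonneg ε)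
    exact ⟨h, h.trans (hcopies S)⟩
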